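/- **Theorem (Counting FloodSet).** Consider $n$ agents with initial values in $\{0,1\}$ in a synchronous message-passing system with at most $t<n$ crash failures: a faulty agent behaves correctly until it crashes in some round; in that round an arbitrary subset of its messages is delivered, and it sends nothing afterwards. In the Counting FloodSet information exchange $\mathcal E$, the local state of an agent is either $\mathit{crashed}$ or a tuple $\langle W,h,m,v\rangle$, where $W$ is the set of values seen so far, $h$ is the number of agents from which no message was received in the last round, $m$ is the time and $v$ is the agent's initial value; it is $\langle\{v\},0,0,v\rangle$ at time $0$. In each round every non-crashed agent sends $W$ to all agents, itself included, and, unless it crashes, adds the received sets to $W$, records the new count $h$ and increments $m$. Decisions do not influence these states. Let $\mathcal I$ be the system of all runs (all initial values and all crash patterns with at most $t$ faulty agents). At a point $(r,m)$, let $\mathcal N(r,m)$ be the set of agents that are not crashed. An agent knows a proposition at a point if it is true at all points of $\mathcal I$ at which the agent has the same local state. $C_{\mathcal N}\varphi$ (common knowledge) means that $E_{\mathcal N}^k\varphi$ holds for all $k\ge 1$, where $E_{\mathcal N}\varphi$ holds at a point if every agent in $\mathcal N$ at that point knows $\varphi$ there. Let $\exists v$ be the proposition that some agent has initial value $v$.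 1. Let $r$ be a run, $m$ a time, and $i$ an agent with local state $\langle W,h,m,v_i\rangle$ at $(r,m)$. Then $C_{\mathcal N}(\exists 0)\vee C_{\mathcal N}(\exists 1)$ holds at $(r,m)$ if and only if $m\ge\min\{t+1,n-1\}$ or $h\ge n-1$. 2. A decision protocol maps the local states of each agent to the actions $\mathtt{decide}(0)$, $\mathtt{decide}(1)$, $\mathtt{noop}$; an agent decides $w$ at $(r,m)$ if it is not crashed at $(r,m)$ and its action there is $\mathtt{decide}(w)$. A decision protocol is an SBA protocol if in every run (Agreement) all decisions, by any agents at any times, are on the same value; (Validity) every decided value is the initial value of some agent; and (Simultaneity) if some agent decides at time $m$, then every agent in $\mathcal N(r,m)$ decides at time $m$. Let $P$ be the protocol in which an agent in state $\langle W,h,m,v\rangle$ performs $\mathtt{decide}(\min W)$ if $m\ge\min\{t+1,n-1\}$ or $h\ge n-1$, and $\mathtt{noop}$ otherwise. Then $P$ is an optimum SBA protocol with respect to $\mathcal E$: it is an SBA protocol, and for every SBA protocol $P'$ with the same information exchange and every pair of runs of $P'$ and $P$ with the same initial values and the same crash pattern, whenever an agent decides at time $m$ in the run of $P'$, it also decides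 at time $m$ in the run of $P$. Moreover, under $P$ every agent eventually decides or crashes. -/

import Mathlib

namespace SBA

/-- The set of initial values `{0, 1}`, ordered by `0 < 1`. -/
abbrev Value := Fin 2

/-- The actions of an agent: decide on a value, or do nothing. -/
inductive Action where
  | decideOn (v : Value)
  | noop

/-- States of the environment. `F m i j = true` means that a message from `i` to `j` is delivered
in the round that leads from time `m` to time `m + 1`; `F m i i = false` means that `i` has crashed
in that round or before. -/
abbrev Adversary (n : ℕ) := ℕ → Fin n → Fin n → Bool

/-- The hard crash failure model with at most `t` faulty agents: an agent that fails to deliver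
some message crashes in that very round; after a crash it never sends anything again. -/
def Crash (n t : ℕ) : Set (Adversary n) :=
  {F | (∀ m i j, F m i j = false → F m i i = false) ∧
       (∀ m i, F m i i = false → ∀ m', m < m' → ∀ k, F m' i k = false) ∧
       {i : Fin n | ∃ m j, F m i j = false}.ncard ≤ t}

/-- Information exchange protocols for `n` agents. The value `none` of an `Option` stands for
`⊥` (no message). The map `initState i` is the inverse of the bijection between the initial states
of `i` and the initial values, so that the initial states of `i` are the values of
`initState i`. -/
structure InfoExchange (n : ℕ) where
  State : Fin n → Type
  Msg : Fin n → Type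
  crashed : ∀ i, State i
  initState : ∀ i, Value → State i
  initState_injective : ∀ i, Function.Injective (initState i)
  send : ∀ i, State i → Action → Fin n → Option (Msg i)
  update : ∀ i, State i → Adversary n → Action → (∀ j, Option (Msg j)) → State i

variable {n : ℕ}

/-- A decision protocol: for each agent, a map from its local states to actions. -/
abbrev DecisionProtocol (E : InfoExchange n) := ∀ i, E.State i → Action

/-- A global state: a state of the environment and a local state of each agent. -/
structure GlobalState (E : InfoExchange n) where
  env : Adversary n
  loc : ∀ i, E.State i

/-- A run maps times to global states; a point is a run together with a time. -/
abbrev Run (E : InfoExchange n) := ℕ → GlobalState E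

/-- The round from time `k` to time `k + 1`, starting in the global state `g`. -/
def step (E : InfoExchange n) (P : DecisionProtocol E) (k : ℕ) (g : GlobalState E) :
    GlobalState E where
  env := g.env
  loc i := E.update i (g.loc i) g.env (P i (g.loc i)) fun j =>
    if g.env k j i = true then E.send j (g.loc j) (P j (g.loc j)) i else none

/-- The set of runs of the decision protocol `P` with the information exchange `E` in the crash
failure model with at most `t` failures. -/
def system (E : InfoExchange n) (t : ℕ) (P : DecisionProtocol E) : Set (Run E) :=
  {r | (r 0).env ∈ Crash n t ∧ (∀ i, ∃ v, (r 0).loc i = E.initState i v) ∧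
       ∀ k, r (k + 1) = step E P k (r k)}

section Knowledge

variable {E : InfoExchange n}

/-- The set of agents that have not failed at a point. -/
def nonfailed (r : Run E) (m : ℕ) : Set (Fin n) := {i | (r m).loc i ≠ E.crashed i}

/-- Propositions that are evaluated at points. -/
abbrev Proposition (E : InfoExchange n) := Run E → ℕ → Prop

/-- Some agent has the initial value `v`. -/
def existsValue (v : Value) : Proposition E := fun r _ => ∃ i, (r 0).loc i = E.initState i v

/-- Agent `i` knows `φ`, in the system of runs `R`. -/
def Knows (R : Set (Run E)) (i : Fin n) (φ : Proposition E) : Proposition E := fun r m =>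
  ∀ r' ∈ R, ∀ m', (r m).loc i = (r' m').loc i → φ r' m'

/-- Every nonfailed agent knows `φ`. -/
def EveryoneKnows (R : Set (Run E)) (φ : Proposition E) : Proposition E := fun r m =>
  ∀ i ∈ nonfailed r m, Knows R i φ r m

/-- `φ` is common knowledge among the nonfailed agents. -/
def CommonKnowledge (R : Set (Run E)) (φ : Proposition E) : Proposition E := fun r m =>
  ∀ k, 1 ≤ k → (EveryoneKnows R)^[k] φ r m

end Knowledge

section Agreement

variable {E : InfoExchange n}

/-- Agent `i` is nonfailed at the point `(r, m)` and decides `v` there (in round `m + 1`). -/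
def Decides (P : DecisionProtocol E) (r : Run E) (m : ℕ) (i : Fin n) (v : Value) : Prop :=
  i ∈ nonfailed r m ∧ P i ((r m).loc i) = Action.decideOn v

/-- Simultaneous Byzantine Agreement protocols with respect to `E`. -/
structure IsSBA (E : InfoExchange n) (t : ℕ) (P : DecisionProtocol E) : Prop where
  agreement : ∀ r ∈ system E t P, ∀ m m' i j v v',
    Decides P r m i v → Decides P r m' j v' → v = v'
  validity : ∀ r ∈ system E t P, ∀ m i v, Decides P r m i v → existsValue v r m
  simultaneity : ∀ r ∈ system E t P, ∀ m i v, Decides P r m i v →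
    ∀ j ∈ nonfailed r m, ∃ w, Decides P r m j w

/-- Every agent eventually decides or fails. -/
def Terminates (E : InfoExchange n) (t : ℕ) (P : DecisionProtocol E) : Prop :=
  ∀ r ∈ system E t P, ∀ i, ∃ m, i ∉ nonfailed r m ∨ ∃ v, Decides P r m i v

/-- Two runs correspond if they have the same initial values and the same adversary. -/
def Corresponds (r r' : Run E) : Prop :=
  (∀ i v, (r 0).loc i = E.initState i v ↔ (r' 0).loc i = E.initState i v) ∧
    (r 0).env = (r' 0).env

/-- In corresponding runs, whenever a nonfailed agent decides under `P`, it also decides under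
`P'` (possibly on another value). -/
def DecidesNoMoreThan (E : InfoExchange n) (t : ℕ) (P P' : DecisionProtocol E) : Prop :=
  ∀ r ∈ system E t P, ∀ r' ∈ system E t P', Corresponds r r' →
    ∀ m i v, Decides P r m i v → ∃ w, Decides P' r' m i w

/-- Optimum SBA protocols with respect to `E`. -/
def IsOptimumSBA (E : InfoExchange n) (t : ℕ) (P : DecisionProtocol E) : Prop :=
  IsSBA E t P ∧ ∀ P' : DecisionProtocol E, IsSBA E t P' → DecidesNoMoreThan E t P' P

end Agreement

/-- The local states of an agent of Counting FloodSet that has not crashed: the set of values seen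
so far, the number of messages missing in the last round, the time, and the initial value. -/
@[ext]
structure CountState where
  seen : Finset Value
  missing : ℕ
  time : ℕ
  init : Value

/-- The Counting FloodSet information exchange. The local state `none` is the crashed state.
A message is delivered to its sender, too, if the sender does not crash. -/
def countFloodSet (n : ℕ) : InfoExchange n where
  State _ := Option CountState
  Msg _ := Finset Value
  crashed _ := none
  initState _ v := some ⟨{v}, 0, 0, v⟩
  initState_injective _ v w h := by
    simpa using congrArg (Option.map CountState.init) h
  send _ s _ _ := s.map CountState.seen
  update i s F _ msgs := s.bind fun s =>
    if F s.time i i = false then none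
    else some
      { seen := s.seen ∪ Finset.univ.biUnion fun j => (msgs j).getD ∅
        missing := (Finset.univ.filter fun j => msgs j = none).card
        time := s.time + 1
        init := s.init }

/-- The Counting FloodSet decision rule. For a nonempty set `W` of values, `W.inf id` is its
minimum. -/
def countRule (n t : ℕ) : DecisionProtocol (countFloodSet n) := fun _ s =>
  match (s : Option CountState) with
  | none => Action.noop
  | some s =>
    if min (t + 1) (n - 1) ≤ s.time then Action.decideOn (s.seen.inf id)
    else if n - 1 ≤ s.missing then Action.decideOn (s.seen.inf id)
    else Action.noop

end SBA

/-! Local states depend only on the initial values and the crash pattern (`describes_of_mem`), so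
runs of different decision protocols can be compared directly.

Sufficiency: if `t + 1` rounds have passed, some round had no new crash and equalised the seen sets;
if time `n - 1` is reached without such a round, or an agent misses `n - 1` messages, at most one
agent is left. So readiness and the seen set are shared by all nonfailed agents (`Ready.of_alive`,
`Ready.seenSet_eq`), and "a ready agent has seen `w`" is an invariant that each of them knows.

Necessity: common knowledge passes between any two points that some nonfailed agent cannot tell
apart. From a point that is not ready, such steps lead to a failure-free run
(`commonlyKnown_iff_noFailure`). All failure-free runs with mixed inputs are linked
(`commonlyKnown_mixed_congr`), and a chain of crashes links them to the constant inputs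
(`commonlyKnown_const_iff`), one of which lacks the value `w`.

Optimality: a decision on `w` in any SBA protocol makes `∃ w` common knowledge
(`IsSBA.commonKnowledge`), hence the point is ready and the rule decides there. -/

namespace SBA

variable {n : ℕ}

/-! ### Local states in terms of inputs and crash pattern -/

/-- Agent `i` has not crashed before time `k`. -/
def Alive (F : Adversary n) (k : ℕ) (i : Fin n) : Prop := ∀ k' < k, F k' i i = true

/-- The values that agent `i` has seen by time `k`, when the initial values are `x`. -/
def seenSet (F : Adversary n) (x : Fin n → Value) : ℕ → Fin n → Finset Value
  | 0, i => {x i}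
  | k + 1, i => seenSet F x k i ∪
      Finset.univ.biUnion fun j => if F k j i = true then seenSet F x k j else ∅

/-- The number of messages to agent `i` that are missing in the round before time `k`. -/
def missingCount (F : Adversary n) : ℕ → Fin n → ℕ
  | 0, _ => 0
  | k + 1, i => (Finset.univ.filter fun j => F k j i = false).card

theorem mem_seenSet_succ {F : Adversary n} {x : Fin n → Value} {k : ℕ} {i : Fin n} {w : Value} :
    w ∈ seenSet F x (k + 1) i ↔
      w ∈ seenSet F x k i ∨ ∃ j, F k j i = true ∧ w ∈ seenSet F x k j := by
  simp only [seenSet, Finset.mem_union, Finset.mem_biUnion, Finset.mem_univ, true_and]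
  refine or_congr_right (exists_congr fun j => ?_)
  split_ifs with h <;> simp [h]

theorem self_mem_seenSet (F : Adversary n) (x : Fin n → Value) (k : ℕ) (i : Fin n) :
    x i ∈ seenSet F x k i := by
  induction k with
  | zero => simp [seenSet]
  | succ k ih => exact mem_seenSet_succ.2 (.inl ih)

theorem exists_of_mem_seenSet {F : Adversary n} {x : Fin n → Value} {k : ℕ} {i : Fin n}
    {w : Value} (h : w ∈ seenSet F x k i) : ∃ j, x j = w := by
  induction k generalizing i with
  | zero => exact ⟨i, (by simpa [seenSet] using h : w = x i).symm⟩
  | succ k ih =>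
    obtain h | ⟨j, -, h⟩ := mem_seenSet_succ.1 h
    exacts [ih h, ih h]

theorem Alive.mono {F : Adversary n} {k m : ℕ} {i : Fin n} (h : Alive F m i) (hk : k ≤ m) :
    Alive F k i := fun k' hk' => h k' (hk'.trans_le hk)

/-! ### When the nonfailed agents have seen the same values -/

section Crash

variable {t : ℕ} {F : Adversary n}

theorem alive_of_delivered (hF : F ∈ Crash n t) {k : ℕ} {i j : Fin n} (h : F k i j = true) :
    Alive F k i := by
  intro k' hk'
  by_contra hc
  simp [hF.2.1 k' i (by simpa using hc) k hk' j] at h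

theorem Alive.delivered (hF : F ∈ Crash n t) {k : ℕ} {i : Fin n} (h : Alive F (k + 1) i)
    (j : Fin n) : F k i j = true := by
  by_contra hc
  simpa [h k k.lt_succ_self] using hF.1 k i j (by simpa using hc)

theorem missingCount_le (hF : F ∈ Crash n t) (k : ℕ) (i : Fin n) : missingCount F k i ≤ t := by
  cases k with
  | zero => simp [missingCount]
  | succ k =>
    refine le_trans ?_ hF.2.2
    rw [missingCount, ← Set.ncard_coe_finset]
    refine Set.ncard_le_ncard (fun j hj => ?_) (Set.toFinite _)
    exact ⟨k, i, by simpa using hj⟩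

/-- Every message delivered later comes from an agent that was still alive when it sent, so it
carries nothing outside `S`. -/
theorem seenSet_eq_of_uniform (hF : F ∈ Crash n t) {x : Fin n → Value} {k m : ℕ} (hkm : k ≤ m)
    {S : Finset Value} (h : ∀ i, Alive F k i → seenSet F x k i = S) :
    ∀ i, Alive F m i → seenSet F x m i = S := by
  induction m, hkm using Nat.le_induction with
  | base => exact h
  | succ m _ ih =>
    intro i hi
    ext w
    rw [mem_seenSet_succ, ih i (hi.mono m.le_succ)]
    refine ⟨?_, Or.inl⟩
    rintro (hw | ⟨j, hj, hw⟩)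
    · exact hw
    · rwa [ih j (alive_of_delivered hF hj)] at hw

/-- Until the first round without a crash, at least one agent crashes in each round. After it, all
nonfailed agents have seen the same values. -/
theorem le_card_dead_or_uniform (hF : F ∈ Crash n t) (x : Fin n → Value) (k : ℕ) :
    k ≤ {i | ¬ Alive F k i}.ncard ∨
      ∀ i j, Alive F k i → Alive F k j → seenSet F x k i = seenSet F x k j := by
  induction k with
  | zero => exact .inl (Nat.zero_le _)
  | succ k ih =>
    obtain hk | hu := ih
    · have hsub : {i | ¬ Alive F k i} ⊆ {i | ¬ Alive F (k + 1) i} :=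
        fun i hi h => hi (h.mono k.le_succ)
      obtain heq | hss := hsub.eq_or_ssubset
      -- No new crash in this round: its senders are exactly the agents alive at time `k`, and each
      -- of them reaches everybody.
      · right
        have hal : ∀ i, Alive F k i → Alive F (k + 1) i := fun i hi => by
          by_contra hc
          exact (heq.symm.subset hc : i ∈ {i | ¬ Alive F k i}) hi
        have hmem : ∀ i w, Alive F (k + 1) i →
            (w ∈ seenSet F x (k + 1) i ↔ ∃ j, Alive F k j ∧ w ∈ seenSet F x k j) := by
          intro i w hi
          rw [mem_seenSet_succ]
          constructor
          · rintro (hw | ⟨j, hj, hw⟩)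
            exacts [⟨i, hi.mono k.le_succ, hw⟩, ⟨j, alive_of_delivered hF hj, hw⟩]
          · rintro ⟨j, hj, hw⟩
            exact .inr ⟨j, (hal j hj).delivered hF i, hw⟩
        intro i j hi hj
        ext w
        rw [hmem i w hi, hmem j w hj]
      · left
        exact hk.trans_lt (Set.ncard_lt_ncard hss (Set.toFinite _))
    · right
      intro i j hi hj
      exact (seenSet_eq_of_uniform hF k.le_succ (S := seenSet F x k i)
        (fun a ha => hu a i ha (hi.mono k.le_succ)) i hi).trans
        (seenSet_eq_of_uniform hF k.le_succ (S := seenSet F x k i)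
        (fun a ha => hu a i ha (hi.mono k.le_succ)) j hj).symm

theorem ncard_dead_le (hF : F ∈ Crash n t) (k : ℕ) : {i | ¬ Alive F k i}.ncard ≤ t := by
  refine le_trans (Set.ncard_le_ncard (fun i hi => ?_) (Set.toFinite _)) hF.2.2
  simp only [Alive, Set.mem_ofPred_eq, not_forall] at hi
  obtain ⟨k', -, h⟩ := hi
  exact ⟨k', i, by simpa using h⟩

/-- Two distinct agents alive leave at most `n - 2` crashed ones, and never more than `t` crash; so
there cannot have been a crash in each of `min (t + 1) (n - 1)` rounds. -/
theorem seenSet_eq_of_min_le (hF : F ∈ Crash n t) (x : Fin n → Value) {k : ℕ}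
    (hk : min (t + 1) (n - 1) ≤ k) {i j : Fin n} (hi : Alive F k i) (hj : Alive F k j) :
    seenSet F x k i = seenSet F x k j := by
  obtain h | h := le_card_dead_or_uniform hF x k
  · have h1 := ncard_dead_le hF k
    by_contra hne
    have hij : i ≠ j := fun h => hne (h ▸ rfl)
    have hsub : {i, j} ⊆ {i | ¬ Alive F k i}ᶜ := by
      rintro a (rfl | rfl) <;> simpa
    have h2 := Set.ncard_le_ncard hsub (Set.toFinite _)
    rw [Set.ncard_pair hij] at h2
    have h3 := Set.ncard_add_ncard_compl {i | ¬ Alive F k i}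
    rw [Nat.card_eq_fintype_card, Fintype.card_fin] at h3
    omega
  · exact h i j hi hj

/-- Agents alive after a round delivered all their messages in it, including the one to themselves,
so `i` and `j` are both absent from the missing senders. -/
theorem eq_of_missingCount (hF : F ∈ Crash n t) {k : ℕ} {i j : Fin n}
    (hm : n - 1 ≤ missingCount F k i) (hi : Alive F k i) (hj : Alive F k j) : i = j := by
  by_contra hij
  cases k with
  | zero =>
    -- At time `0` the count is `0`, so the hypothesis forces `n ≤ 1`.
    rw [missingCount] at hm
    exact hij (Fin.ext (by omega))
  | succ k =>
    have hsub : (Finset.univ.filter fun a => F k a i = false) ⊆ Finset.univ \ {i, j} := by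
      intro a ha
      simp only [Finset.mem_filter, Finset.mem_univ, true_and] at ha
      simp only [Finset.mem_sdiff, Finset.mem_univ, true_and, Finset.mem_insert,
        Finset.mem_singleton]
      rintro (rfl | rfl)
      · simp [hi.delivered hF] at ha
      · simp [hj.delivered hF] at ha
    have h1 := Finset.card_le_card hsub
    rw [Finset.card_sdiff_of_subset (Finset.subset_univ _), Finset.card_pair hij,
      Finset.card_univ, Fintype.card_fin] at h1
    rw [missingCount] at hm
    have := i.2; have := j.2
    have : (i : ℕ) ≠ j := fun h => hij (Fin.ext h)
    omega

/-- The condition under which the Counting FloodSet rule decides. -/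
def Ready (t : ℕ) (F : Adversary n) (k : ℕ) (i : Fin n) : Prop :=
  min (t + 1) (n - 1) ≤ k ∨ n - 1 ≤ missingCount F k i

theorem Ready.seenSet_eq (hF : F ∈ Crash n t) (x : Fin n → Value) {k : ℕ} {i j : Fin n}
    (h : Ready t F k i) (hi : Alive F k i) (hj : Alive F k j) :
    seenSet F x k i = seenSet F x k j := by
  obtain h | h := h
  · exact seenSet_eq_of_min_le hF x h hi hj
  · rw [eq_of_missingCount hF h hi hj]

theorem Ready.of_alive (hF : F ∈ Crash n t) {k : ℕ} {i j : Fin n}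
    (h : Ready t F k i) (hi : Alive F k i) (hj : Alive F k j) : Ready t F k j := by
  obtain h' | h' := h
  · exact .inl h'
  · rw [← eq_of_missingCount hF h' hi hj]
    exact .inr h'

end Crash

/-! ### Runs are determined by inputs and crash pattern -/

section Runs

variable {t : ℕ} {P : DecisionProtocol (countFloodSet n)}

/-- The run `r` has the initial values `x` and the adversary `F`. -/
structure Describes (t : ℕ) (r : Run (countFloodSet n)) (x : Fin n → Value) (F : Adversary n) :
    Prop where
  crash : F ∈ Crash n t
  env : (r 0).env = F
  loc_zero : ∀ i, (r 0).loc i = (countFloodSet n).initState i (x i)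
  loc_alive : ∀ k i, Alive F k i →
    (r k).loc i = some ⟨seenSet F x k i, missingCount F k i, k, x i⟩
  loc_dead : ∀ k i, ¬ Alive F k i → (r k).loc i = none

theorem alive_succ {F : Adversary n} {k : ℕ} {i : Fin n} :
    Alive F (k + 1) i ↔ Alive F k i ∧ F k i i = true := by
  refine ⟨fun h => ⟨h.mono k.le_succ, h k k.lt_succ_self⟩, fun h k' hk' => ?_⟩
  obtain h' | rfl := Nat.lt_succ_iff_lt_or_eq.1 hk'
  exacts [h.1 k' h', h.2]

/-- Neither `send` nor `update` looks at the action, so the description is the same for every `P`.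
-/
theorem describes_of_mem {r : Run (countFloodSet n)} {x : Fin n → Value} {F : Adversary n}
    (hr : r ∈ system (countFloodSet n) t P) (henv : (r 0).env = F)
    (hx : ∀ i, (r 0).loc i = (countFloodSet n).initState i (x i)) : Describes t r x F := by
  obtain ⟨hF, -, hstep⟩ := hr
  rw [henv] at hF
  have key : ∀ k, (r k).env = F ∧ ∀ i,
      (Alive F k i → (r k).loc i = some ⟨seenSet F x k i, missingCount F k i, k, x i⟩) ∧
      (¬ Alive F k i → (r k).loc i = none) := by
    intro k
    induction k with
    | zero =>
      refine ⟨henv, fun i => ⟨fun _ => hx i, fun h => (h fun k' hk' => ?_).elim⟩⟩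
      simp at hk'
    | succ k ih =>
      obtain ⟨ihe, ih⟩ := ih
      refine ⟨by rw [hstep k]; exact ihe, fun i => ?_⟩
      have hloc : (r (k + 1)).loc i = ((r k).loc i : Option CountState).bind fun s =>
          if F s.time i i = false then none
          else some
            { seen := s.seen ∪ Finset.univ.biUnion fun j =>
                (if F k j i = true then some (seenSet F x k j) else none).getD ∅
              missing := (Finset.univ.filter fun j =>
                (if F k j i = true then some (seenSet F x k j) else none) = none).card
              time := s.time + 1
              init := s.init } := by
        have hm : (fun j => if (r k).env k j i = true then
              ((r k).loc j : Option CountState).map CountState.seen else none) =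
            fun j => if F k j i = true then some (seenSet F x k j) else none := by
          funext j
          rw [ihe]
          -- The sender of a delivered message is alive, so its state is not `none`: the value
          -- `none` marks exactly the lost messages, which is what `missing` counts.
          split_ifs with h
          · rw [(ih j).1 (alive_of_delivered hF h)]; rfl
          · rfl
        rw [hstep k]
        change ((r k).loc i : Option CountState).bind _ = _
        rw [ihe] at hm ⊢
        have hm' : ∀ j, (if F k j i = true then
              (countFloodSet n).send j ((r k).loc j) (P j ((r k).loc j)) i else none) =
            if F k j i = true then some (seenSet F x k j) else none := fun j => congrFun hm j
        simp only [hm']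
      by_cases hi : Alive F k i
      · rw [(ih i).1 hi] at hloc
        rw [hloc, alive_succ]
        cases hii : F k i i
        · simp only [Option.bind_some, hii, if_true]
          exact ⟨fun h => absurd h.2 Bool.false_ne_true, fun _ => rfl⟩
        · simp only [hi, and_self, forall_const, not_true_eq_false, IsEmpty.forall_iff, and_true,
            Option.bind_some, hii, Bool.true_eq_false, if_false]
          congr 2
          · simp only [seenSet]
            congr 1
            refine Finset.biUnion_congr rfl fun j _ => ?_
            split_ifs <;> rfl
          · simp only [missingCount]
            congr 1
            ext j
            cases F k j i <;> simp
      · rw [(ih i).2 hi] at hloc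
        rw [hloc, alive_succ]
        exact ⟨fun h => absurd h.1 hi, fun _ => rfl⟩
  exact ⟨hF, henv, hx, fun k i => ((key k).2 i).1, fun k i => ((key k).2 i).2⟩

theorem exists_describes {r : Run (countFloodSet n)} (hr : r ∈ system (countFloodSet n) t P) :
    ∃ x F, Describes t r x F := by
  choose x hx using hr.2.1
  exact ⟨x, _, describes_of_mem hr rfl hx⟩

theorem exists_run (P : DecisionProtocol (countFloodSet n)) (x : Fin n → Value) {F : Adversary n}
    (hF : F ∈ Crash n t) : ∃ r ∈ system (countFloodSet n) t P, Describes t r x F := by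
  let r : Run (countFloodSet n) := fun k =>
    Nat.rec ⟨F, fun i => (countFloodSet n).initState i (x i)⟩ (fun k g => step _ P k g) k
  have hr : r ∈ system (countFloodSet n) t P := ⟨hF, fun i => ⟨x i, rfl⟩, fun k => rfl⟩
  exact ⟨r, hr, describes_of_mem hr rfl fun i => rfl⟩

variable {r : Run (countFloodSet n)} {x : Fin n → Value} {F : Adversary n}

theorem Describes.mem_nonfailed (h : Describes t r x F) {k : ℕ} {i : Fin n} :
    i ∈ nonfailed r k ↔ Alive F k i := by
  by_cases hi : Alive F k i
  · simp only [nonfailed, Set.mem_ofPred_eq, h.loc_alive k i hi, hi, iff_true]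
    exact Option.some_ne_none _
  · simp only [nonfailed, Set.mem_ofPred_eq, h.loc_dead k i hi, hi, iff_false, not_not]
    rfl

theorem Describes.of_loc_eq_some (h : Describes t r x F) {k : ℕ} {i : Fin n} {s : CountState}
    (hs : (r k).loc i = some s) :
    Alive F k i ∧ s = ⟨seenSet F x k i, missingCount F k i, k, x i⟩ := by
  by_cases hi : Alive F k i
  · exact ⟨hi, Option.some_injective _ (hs.symm.trans (h.loc_alive k i hi))⟩
  · exact absurd (hs.symm.trans (h.loc_dead k i hi)) (Option.some_ne_none s)

theorem Describes.existsValue_iff (h : Describes t r x F) {w : Value} {k : ℕ} :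
    existsValue w r k ↔ ∃ i, x i = w := by
  refine exists_congr fun i => ?_
  rw [h.loc_zero i]
  exact ((countFloodSet n).initState_injective i).eq_iff

end Runs

/-! ### Common knowledge, and its necessity for simultaneous decisions -/

section CommonKnowledge

variable {E : InfoExchange n} {R : Set (Run E)} {φ : Proposition E}

/-- Level `k + 1` at one point yields level `k` at every point that `i` confuses with it. This is
the single step of all the indistinguishability chains below. -/
theorem CommonKnowledge.of_loc_eq {r r' : Run E} {m m' : ℕ} {i : Fin n}
    (h : CommonKnowledge R φ r m) (hi : i ∈ nonfailed r m) (hr' : r' ∈ R)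
    (hl : (r m).loc i = (r' m').loc i) : CommonKnowledge R φ r' m' := by
  intro k hk
  have := h (k + 1) (by omega)
  rw [Function.iterate_succ_apply'] at this
  exact this i hi r' hr' m' hl

theorem CommonKnowledge.holds {r : Run E} {m : ℕ} {i : Fin n}
    (h : CommonKnowledge R φ r m) (hi : i ∈ nonfailed r m) (hr : r ∈ R) : φ r m :=
  h 1 le_rfl i hi r hr m rfl

/-- The induction rule for common knowledge. -/
theorem commonKnowledge_of_invariant (ψ : Proposition E)
    (h1 : ∀ r ∈ R, ∀ m, ψ r m → φ r m)
    (h2 : ∀ r ∈ R, ∀ m, ψ r m → EveryoneKnows R ψ r m)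
    {r : Run E} (hr : r ∈ R) {m : ℕ} (h : ψ r m) : CommonKnowledge R φ r m := by
  intro k _
  suffices ∀ k, ∀ r ∈ R, ∀ m, ψ r m → (EveryoneKnows R)^[k] φ r m from this k r hr m h
  intro k
  induction k with
  | zero => exact h1
  | succ k ih =>
    intro r hr m hψ
    rw [Function.iterate_succ_apply']
    exact fun i hi r' hr' m' hl => ih r' hr' m' (h2 r hr m hψ i hi r' hr' m' hl)

/-- "Some agent decides `w` now" is an invariant: by simultaneity and agreement every nonfailed
agent decides `w` too, and it reads this off its own state. Validity gives `existsValue w`. -/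
theorem IsSBA.commonKnowledge {t : ℕ} {P : DecisionProtocol E} (hP : IsSBA E t P) {r : Run E}
    (hr : r ∈ system E t P) {m : ℕ} {i : Fin n} {w : Value} (h : Decides P r m i w) :
    CommonKnowledge (system E t P) (existsValue w) r m := by
  refine commonKnowledge_of_invariant (fun r m => ∃ i, Decides P r m i w) ?_ ?_ hr ⟨i, h⟩
  · rintro r hr m ⟨i, hi⟩
    exact hP.validity r hr m i w hi
  · rintro r hr m ⟨i, hi⟩ j hj r' hr' m' hl
    obtain ⟨w', hw'⟩ := hP.simultaneity r hr m i w hi j hj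
    obtain rfl := hP.agreement r hr m m i j w w' hi hw'
    refine ⟨j, ?_, hl ▸ hw'.2⟩
    have := hw'.1
    simp only [nonfailed, Set.mem_ofPred_eq] at this ⊢
    rwa [← hl]

end CommonKnowledge

/-! ### Necessity: indistinguishability chains from points that are not ready -/

section Necessity

/-- It is common knowledge at time `m` that `w` is an initial value, in the run with the initial
values `x` and the adversary `F`. -/
def CommonlyKnown (t : ℕ) (P : DecisionProtocol (countFloodSet n)) (w : Value) (m : ℕ)
    (x : Fin n → Value) (F : Adversary n) : Prop :=
  ∃ r ∈ system (countFloodSet n) t P, Describes t r x F ∧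
    CommonKnowledge (system (countFloodSet n) t P) (existsValue w) r m

variable {t : ℕ} {P : DecisionProtocol (countFloodSet n)} {w : Value} {m : ℕ}

theorem CommonlyKnown.of_same_state {x x' : Fin n → Value} {F F' : Adversary n} {i : Fin n}
    (h : CommonlyKnown t P w m x F) (hF' : F' ∈ Crash n t)
    (hi : Alive F m i) (hi' : Alive F' m i) (hx : x i = x' i)
    (hs : seenSet F x m i = seenSet F' x' m i) (hm : missingCount F m i = missingCount F' m i) :
    CommonlyKnown t P w m x' F' := by
  obtain ⟨r, hr, hd, hck⟩ := h
  obtain ⟨r', hr', hd'⟩ := exists_run P x' hF'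
  refine ⟨r', hr', hd', hck.of_loc_eq (hd.mem_nonfailed.2 hi) hr' ?_⟩
  rw [hd.loc_alive m i hi, hd'.loc_alive m i hi', hx, hs, hm]

theorem commonlyKnown_congr {x x' : Fin n → Value} {F F' : Adversary n} (i : Fin n)
    (hF : F ∈ Crash n t) (hF' : F' ∈ Crash n t)
    (hi : Alive F m i) (hi' : Alive F' m i) (hx : x i = x' i)
    (hs : seenSet F x m i = seenSet F' x' m i) (hm : missingCount F m i = missingCount F' m i) :
    CommonlyKnown t P w m x F ↔ CommonlyKnown t P w m x' F' :=
  ⟨fun h => h.of_same_state hF' hi hi' hx hs hm,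
    fun h => h.of_same_state hF hi' hi hx.symm hs.symm hm.symm⟩

/-- The adversary without failures. -/
def noFailure (n : ℕ) : Adversary n := fun _ _ _ => true

theorem noFailure_mem : noFailure n ∈ Crash n t := by
  refine ⟨?_, ?_, ?_⟩ <;> simp [noFailure]

theorem alive_noFailure (k : ℕ) (i : Fin n) : Alive (noFailure n) k i := fun _ _ => rfl

theorem not_commonlyKnown_const (hn : 0 < n) {b : Value} (hb : b ≠ w) :
    ¬ CommonlyKnown t P w m (fun _ => b) (noFailure n) := by
  rintro ⟨r, hr, hd, hck⟩
  obtain ⟨-, hi⟩ := hd.existsValue_iff.1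
    (hck.holds (hd.mem_nonfailed.2 (alive_noFailure m ⟨0, hn⟩)) hr)
  exact hb hi

/-- The agents in `T` crash in the round that starts at time `k`, and only their messages to `i`
and to themselves are lost. -/
def crashTowards (k : ℕ) (i : Fin n) (T : Finset (Fin n)) : Adversary n := fun k' a c =>
  !decide (a ∈ T ∧ (k < k' ∨ k' = k ∧ (c = i ∨ c = a)))

theorem crashTowards_eq_false {k k' : ℕ} {i a c : Fin n} {T : Finset (Fin n)} :
    crashTowards k i T k' a c = false ↔ a ∈ T ∧ (k < k' ∨ k' = k ∧ (c = i ∨ c = a)) := by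
  rw [crashTowards, Bool.not_eq_false', decide_eq_true_eq]

theorem crashTowards_mem {k : ℕ} {i : Fin n} {T : Finset (Fin n)} (hT : T.card ≤ t) :
    crashTowards k i T ∈ Crash n t := by
  refine ⟨?_, ?_, ?_⟩
  · intro k' a c
    simp only [crashTowards_eq_false]
    tauto
  · intro k' a h k'' hk'' c
    rw [crashTowards_eq_false] at h ⊢
    exact ⟨h.1, .inl (by omega)⟩
  · refine le_trans ?_ hT
    rw [← Set.ncard_coe_finset]
    refine Set.ncard_le_ncard ?_ (Set.toFinite _)
    rintro a ⟨k', c, h⟩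
    exact (crashTowards_eq_false.1 h).1

theorem alive_crashTowards {k m : ℕ} {i a : Fin n} {T : Finset (Fin n)} (ha : a ∉ T) :
    Alive (crashTowards k i T) m a := fun k' _ => by
  simp [crashTowards, ha]

theorem missingCount_crashTowards {k : ℕ} {i : Fin n} {T : Finset (Fin n)} :
    missingCount (crashTowards k i T) (k + 1) i = T.card := by
  rw [missingCount]
  congr 1
  ext a
  simp [crashTowards_eq_false]

theorem missingCount_crashTowards_of_ne {k : ℕ} {i j : Fin n} {T : Finset (Fin n)} (hj : j ∉ T)
    (hij : j ≠ i) : missingCount (crashTowards k i T) (k + 1) j = 0 := by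
  rw [missingCount, Finset.card_eq_zero]
  ext a
  simp only [Finset.mem_filter, Finset.mem_univ, true_and, crashTowards_eq_false, lt_irrefl,
    false_or, hij, Finset.notMem_empty, iff_false, not_and]
  rintro ha rfl
  exact hj ha

theorem seenSet_succ_eq {F : Adversary n} {x : Fin n → Value} {k : ℕ} {i j : Fin n}
    (h : F k j i = true) (hx : ∀ a, x a ∈ ({x i, x j} : Finset Value)) :
    seenSet F x (k + 1) i = {x i, x j} := by
  refine Finset.Subset.antisymm (fun v hv => ?_) (fun v hv => ?_)
  · obtain ⟨a, rfl⟩ := exists_of_mem_seenSet hv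
    exact hx a
  · rw [mem_seenSet_succ]
    simp only [Finset.mem_insert, Finset.mem_singleton] at hv
    obtain rfl | rfl := hv
    · exact .inl (self_mem_seenSet F x k i)
    · exact .inr ⟨j, h, self_mem_seenSet F x k j⟩

/-- An agent that has received a message from another agent in the last round cannot exclude that
all other agents believe that there have been no failures. -/
theorem commonlyKnown_iff_noFailure {x x' : Fin n → Value} {F : Adversary n} {k : ℕ}
    (i j : Fin n) (hij : j ≠ i) (hF : F ∈ Crash n t) (hi : Alive F (k + 1) i)
    (hm : missingCount F (k + 1) i + 2 ≤ n) (hxi : x i = x' i)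
    (hs : seenSet F x (k + 1) i = {x' i, x' j})
    (hx' : ∀ a, x' a ∈ ({x' i, x' j} : Finset Value)) :
    CommonlyKnown t P w (k + 1) x F ↔ CommonlyKnown t P w (k + 1) x' (noFailure n) := by
  -- Agent `i` knows how many messages were lost, but not whose. The blame goes to agents `T` other
  -- than `j`, crashing only in the last round.
  obtain ⟨T, hT, hTc⟩ : ∃ T ⊆ Finset.univ \ {i, j}, T.card = missingCount F (k + 1) i := by
    refine Finset.exists_subset_card_eq ?_
    rw [Finset.card_sdiff_of_subset (Finset.subset_univ _), Finset.card_pair hij.symm,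
      Finset.card_univ, Fintype.card_fin]
    omega
  have hiT : i ∉ T := fun h => by simpa using hT h
  have hjT : j ∉ T := fun h => by simpa using hT h
  have hG : crashTowards k i T ∈ Crash n t :=
    crashTowards_mem (hTc ▸ missingCount_le hF _ _)
  have hx'' : ∀ a, x' a ∈ ({x' j, x' i} : Finset Value) := fun a => by
    rw [Finset.pair_comm]; exact hx' a
  -- Two steps: `i` confuses `F` with `crashTowards`; there `j` misses no message and has seen all
  -- values of `x'`, so `j` confuses it with the failure-free run.
  rw [commonlyKnown_congr i hF hG hi (alive_crashTowards hiT) hxi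
      (hs.trans (seenSet_succ_eq ((alive_crashTowards hjT).delivered hG i) hx').symm)
      (hTc.symm.trans missingCount_crashTowards.symm),
    commonlyKnown_congr j hG noFailure_mem (alive_crashTowards hjT) (alive_noFailure _ _) rfl
      ((seenSet_succ_eq ((alive_crashTowards hiT).delivered hG j) hx'').trans
        (seenSet_succ_eq ((alive_noFailure (k + 1) i).delivered (noFailure_mem (t := t)) j)
          hx'').symm)
      ((missingCount_crashTowards_of_ne hjT hij).trans (by simp [missingCount, noFailure]))]

theorem value_mem_pair {a b : Value} (h : a ≠ b) (c : Value) : c ∈ ({a, b} : Finset Value) := by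
  revert a b c; decide

theorem value_eq_of_ne {a b c : Value} (h1 : a ≠ c) (h2 : b ≠ c) : a = b := by
  revert a b c; decide

/-- Both inputs are mixed, so in either run agent `i` has seen both values and missed nothing; its
own initial value is all that could differ. -/
theorem commonlyKnown_noFailure_congr {x x' : Fin n → Value} {k : ℕ} (hn : 2 ≤ n) {i j j' : Fin n}
    (hi : x i = x' i) (hj : x j ≠ x i) (hj' : x' j' ≠ x' i) :
    CommonlyKnown t P w (k + 1) x (noFailure n) ↔
      CommonlyKnown t P w (k + 1) x' (noFailure n) := by
  refine commonlyKnown_iff_noFailure i j' (fun h => hj' (h ▸ rfl)) noFailure_mem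
    (alive_noFailure _ _) (by simpa [missingCount, noFailure] using hn) hi ?_
    (fun _ => value_mem_pair hj'.symm _)
  rw [seenSet_succ_eq (j := j) rfl (fun _ => value_mem_pair hj.symm _), hi, value_eq_of_ne (show x j ≠ x' i from hi ▸ hj) hj']

theorem commonlyKnown_mixed_congr {x x' : Fin n → Value} {k : ℕ} (hn : 3 ≤ n) {i j i' j' : Fin n}
    (h : x i ≠ x j) (h' : x' i' ≠ x' j') :
    CommonlyKnown t P w (k + 1) x (noFailure n) ↔
      CommonlyKnown t P w (k + 1) x' (noFailure n) := by
  have hmix : ∀ {y : Fin n → Value} {a b : Fin n}, y a ≠ y b → ∀ c, ∃ d, y d ≠ y c := by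
    intro y a b hab c
    by_contra! hc
    exact hab ((hc a).trans (hc b).symm)
  by_cases hd : ∃ d, x d = x' d
  · obtain ⟨d, hd⟩ := hd
    obtain ⟨a, ha⟩ := hmix h d
    obtain ⟨a', ha'⟩ := hmix h' d
    exact commonlyKnown_noFailure_congr (by omega) hd ha ha'
  -- The inputs are complementary. The intermediate input `z` is mixed, agrees with `x` at `i` and
  -- with `x'` at `j`; a third agent `d` is needed to carry the other value.
  · push Not at hd
    obtain ⟨d, hd1⟩ : ∃ d, d ∉ ({i, j} : Finset (Fin n)) := by
      by_contra! hc
      have h1 := Finset.card_le_card (fun a _ => hc a : Finset.univ ⊆ ({i, j} : Finset (Fin n)))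
      have h2 := Finset.card_le_two (a := i) (b := j)
      rw [Finset.card_univ, Fintype.card_fin] at h1
      omega
    simp only [Finset.mem_insert, Finset.mem_singleton, not_or] at hd1
    let z : Fin n → Value := Function.update (fun _ => x i) d (x j)
    have hzi : z i = x i := Function.update_of_ne (Ne.symm hd1.1) _ _
    have hzj : z j = x i := Function.update_of_ne (Ne.symm hd1.2) _ _
    have hzd : z d = x j := Function.update_self _ _ _
    obtain ⟨a', ha'⟩ := hmix h' j
    rw [commonlyKnown_noFailure_congr (x' := z) (by omega) hzi.symm h.symm
      (by rw [hzd, hzi]; exact h.symm : z d ≠ z i)]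
    exact commonlyKnown_noFailure_congr (by omega)
      (hzj.trans (value_eq_of_ne h (hd j).symm)) (by rw [hzd, hzj]; exact h.symm : z d ≠ z j) ha'

/-! ### Linking constant inputs to mixed inputs by a chain of crashes -/

/-- In each of the first `m` rounds, one agent crashes, and only its message to the agent that
crashes next is delivered. -/
def crashChain (n m : ℕ) : Adversary n := fun k i j =>
  decide (k < (i : ℕ) ∨ m ≤ (i : ℕ) ∨ (i : ℕ) = k ∧ (j : ℕ) = k + 1)

theorem crashChain_eq_true {k : ℕ} {i j : Fin n} : crashChain n m k i j = true ↔
    k < (i : ℕ) ∨ m ≤ (i : ℕ) ∨ (i : ℕ) = k ∧ (j : ℕ) = k + 1 := by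
  simp [crashChain]

theorem crashChain_eq_false {k : ℕ} {i j : Fin n} : crashChain n m k i j = false ↔
    (i : ℕ) ≤ k ∧ (i : ℕ) < m ∧ ((i : ℕ) = k → (j : ℕ) ≠ k + 1) := by
  simp [crashChain]

theorem card_filter_lt (hm : m ≤ n) : (Finset.univ.filter fun i : Fin n => (i : ℕ) < m).card = m := by
  rw [Fin.card_filter_val_lt, min_eq_right hm]

theorem crashChain_mem (hm : m ≤ t) (hmn : m ≤ n) : crashChain n m ∈ Crash n t := by
  refine ⟨?_, ?_, ?_⟩
  · intro k i j h
    rw [crashChain_eq_false] at h ⊢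
    exact ⟨h.1, h.2.1, by omega⟩
  · intro k i h k' hk' j
    rw [crashChain_eq_false] at h ⊢
    exact ⟨by omega, h.2.1, by omega⟩
  · refine le_trans ?_ ((card_filter_lt hmn).le.trans hm)
    rw [← Set.ncard_coe_finset]
    refine Set.ncard_le_ncard ?_ (Set.toFinite _)
    rintro i ⟨k, j, h⟩
    simpa using (crashChain_eq_false.1 h).2.1

theorem alive_crashChain {k : ℕ} {i : Fin n} (hi : m ≤ (i : ℕ)) : Alive (crashChain n m) k i :=
  fun _ _ => crashChain_eq_true.2 (.inr (.inl hi))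

theorem mem_seenSet_crashChain {x : Fin n → Value} {z i : Fin n} (hz : (z : ℕ) = 0) {k : ℕ}
    (hi : (i : ℕ) = k) : x z ∈ seenSet (crashChain n m) x k i := by
  induction k generalizing i with
  | zero =>
    obtain rfl : i = z := Fin.ext (hi.trans hz.symm)
    exact self_mem_seenSet _ _ _ _
  | succ k ih =>
    refine mem_seenSet_succ.2 (.inr ⟨⟨k, by omega⟩, ?_, ih rfl⟩)
    exact crashChain_eq_true.2 (.inr (.inr ⟨rfl, hi⟩))

/-- The value of agent `0` advances by one agent per round, so beyond index `k` it is unknown at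
time `k`. -/
theorem seenSet_crashChain {x : Fin n → Value} {b : Value} (hx : ∀ i : Fin n, (i : ℕ) ≠ 0 → x i = b)
    {k : ℕ} (hk : k ≤ m) {i : Fin n} (hi : k < (i : ℕ)) :
    seenSet (crashChain n m) x k i = {b} := by
  induction k generalizing i with
  | zero => rw [seenSet, hx i (by omega)]
  | succ k ih =>
    ext v
    rw [mem_seenSet_succ, ih (by omega) (by omega)]
    refine ⟨?_, Or.inl⟩
    rintro (h | ⟨j, hj, h⟩)
    · exact h
    · rw [crashChain_eq_true] at hj
      rwa [ih (by omega) (by omega)] at h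

theorem missingCount_crashChain {k : ℕ} {i : Fin n} (hk : k + 1 = m) (hi : k + 1 < (i : ℕ)) :
    missingCount (crashChain n m) (k + 1) i = m := by
  rw [missingCount]
  refine Eq.trans ?_ (card_filter_lt (n := n) (m := m) (by omega))
  congr 1
  ext j
  simp only [Finset.mem_filter, Finset.mem_univ, true_and, crashChain_eq_false]
  omega

/-- One less than for the later agents: the last crashing agent, `k`, still reaches the end of the
chain. -/
theorem missingCount_crashChain_eq {k : ℕ} {i : Fin n} (hk : k + 1 = m) (hi : (i : ℕ) = k + 1) :
    missingCount (crashChain n m) (k + 1) i = k := by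
  rw [missingCount]
  refine Eq.trans ?_ (card_filter_lt (n := n) (m := k) (by omega))
  congr 1
  ext j
  simp only [Finset.mem_filter, Finset.mem_univ, true_and, crashChain_eq_false]
  omega

/-- In the crash chain only agent `0` starts with `c`. The end `p` of the chain learns `c` in the
last round, while `q` has seen only `b`. So `q` links the chain to the constant input and `p` links
it to the mixed one. -/
theorem commonlyKnown_const_iff {k : ℕ} (hk : k + 1 ≤ t) (hkn : k + 3 ≤ n) {b c : Value}
    (hbc : b ≠ c) :
    CommonlyKnown t P w (k + 1) (fun _ => b) (noFailure n) ↔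
      CommonlyKnown t P w (k + 1) (fun i => if (i : ℕ) = 0 then c else b) (noFailure n) := by
  let x : Fin n → Value := fun i => if (i : ℕ) = 0 then c else b
  have hG : crashChain n (k + 1) ∈ Crash n t := crashChain_mem hk (by omega)
  let z : Fin n := ⟨0, by omega⟩
  let p : Fin n := ⟨k + 1, by omega⟩
  let q : Fin n := ⟨k + 2, by omega⟩
  have hxz : x z = c := rfl
  have hxb : ∀ i : Fin n, (i : ℕ) ≠ 0 → x i = b := fun i hi => if_neg hi
  have hxp : x p = b := hxb p (by simp [p])
  have hxq : x q = b := hxb q (by simp [q])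
  have hpz : z ≠ p := fun h => by simpa [z, p] using congrArg Fin.val h
  have hqz : z ≠ q := fun h => by simpa [z, q] using congrArg Fin.val h
  -- Agent `q` misses `k + 1` messages; the bound `k + 3 ≤ n` leaves just enough room for the two
  -- agents that must not be blamed.
  rw [← commonlyKnown_iff_noFailure (x := x) q z hqz hG
    (alive_crashChain (by simp [q])) (by rw [missingCount_crashChain rfl (by simp [q])]; omega)
    hxq (by rw [seenSet_crashChain hxb le_rfl (by simp [q])]; simp) (by simp)]
  refine commonlyKnown_iff_noFailure p z hpz hG (alive_crashChain le_rfl)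
    (by rw [missingCount_crashChain_eq rfl rfl]; omega) rfl ?_ ?_
  · change _ = {x p, x z}
    refine Finset.Subset.antisymm (fun v _ => ?_) (fun v hv => ?_)
    · rw [hxp, hxz]; exact value_mem_pair hbc v
    · simp only [Finset.mem_insert, Finset.mem_singleton] at hv
      obtain rfl | rfl := hv
      · exact self_mem_seenSet _ _ _ _
      · exact mem_seenSet_crashChain (z := z) rfl rfl
  · change ∀ a, x a ∈ ({x p, x z} : Finset Value)
    rw [hxp, hxz]
    exact fun a => value_mem_pair hbc _

/-- Any failure-free run is linked, through mixed inputs, to the one where all agents start with `b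
≠ w`, and there `∃ w` is false. -/
theorem not_commonlyKnown_noFailure {k : ℕ} (hk : k + 1 ≤ t) (hkn : k + 3 ≤ n)
    (x : Fin n → Value) : ¬ CommonlyKnown t P w (k + 1) x (noFailure n) := by
  obtain ⟨b, hb⟩ : ∃ b : Value, b ≠ w := exists_ne w
  have hne : ∀ {c d : Value}, c ≠ d →
      (fun i : Fin n => if (i : ℕ) = 0 then c else d) ⟨0, by omega⟩ ≠
        (fun i : Fin n => if (i : ℕ) = 0 then c else d) ⟨1, by omega⟩ := by
    intro c d h
    simpa using h
  have hmixed : ∀ (y : Fin n → Value) (i j : Fin n), y i ≠ y j →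
      ¬ CommonlyKnown t P w (k + 1) y (noFailure n) := by
    intro y i j hij
    rw [commonlyKnown_mixed_congr (x' := fun i => if (i : ℕ) = 0 then w else b) (by omega) hij
        (hne hb.symm),
      ← commonlyKnown_const_iff hk hkn hb]
    exact not_commonlyKnown_const (by omega) hb
  by_cases hx : ∃ i j, x i ≠ x j
  · obtain ⟨i, j, hij⟩ := hx
    exact hmixed x i j hij
  · push Not at hx
    obtain ⟨c, hc⟩ : ∃ c : Value, c ≠ x ⟨0, by omega⟩ := exists_ne _
    have : x = fun _ => x ⟨0, by omega⟩ := funext fun i => hx _ _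
    rw [this, commonlyKnown_const_iff hk hkn hc.symm]
    exact hmixed _ _ _ (hne hc)

/-- At time `0` an agent knows only its own value: `i` allows all others to have `b`, and then `j`
allows `i` to have `b` as well. -/
theorem not_commonlyKnown_zero (hn : 2 ≤ n) {x : Fin n → Value} {F : Adversary n}
    (hF : F ∈ Crash n t) (i : Fin n) : ¬ CommonlyKnown t P w 0 x F := by
  obtain ⟨b, hb⟩ : ∃ b : Value, b ≠ w := exists_ne w
  have : Nontrivial (Fin n) := Fin.nontrivial_iff_two_le.2 hn
  obtain ⟨j, hj⟩ := exists_ne i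
  have hal : ∀ (G : Adversary n) a, Alive G 0 a := fun G a k hk => by simp at hk
  rw [commonlyKnown_congr (x' := Function.update (fun _ => b) i (x i)) i hF noFailure_mem
    (hal _ _) (hal _ _) (by simp) (by simp [seenSet]) rfl,
    commonlyKnown_congr (x' := fun _ => b) j noFailure_mem noFailure_mem
    (hal _ _) (hal _ _) (by simp [hj]) (by simp [seenSet, hj]) rfl]
  exact not_commonlyKnown_const (by omega) hb

theorem CommonlyKnown.ready {x : Fin n → Value} {F : Adversary n} (hF : F ∈ Crash n t)
    {i : Fin n} (hi : Alive F m i) (h : CommonlyKnown t P w m x F) : Ready t F m i := by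
  by_contra hc
  rw [Ready, not_or, not_le, not_le, lt_min_iff] at hc
  obtain ⟨⟨hmt, hmn⟩, hmiss⟩ := hc
  cases m with
  | zero => exact not_commonlyKnown_zero (by omega) hF i h
  | succ k =>
    have : Nontrivial (Fin n) := Fin.nontrivial_iff_two_le.2 (by omega)
    obtain ⟨j, hj⟩ := exists_ne i
    -- With two values available, a set containing `x i` has this form, possibly with `c = x i`. The
    -- input `x'` then realises it by giving `c` to `j` alone.
    obtain ⟨c, hc⟩ : ∃ c, seenSet F x (k + 1) i = {x i, c} := by
      have := self_mem_seenSet F x (k + 1) i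
      generalize seenSet F x (k + 1) i = S at this
      generalize x i = v at this
      revert S v; decide
    let x' : Fin n → Value := Function.update (fun _ => x i) j c
    have hi' : x' i = x i := Function.update_of_ne hj.symm _ _
    have hj' : x' j = c := Function.update_self _ _ _
    rw [commonlyKnown_iff_noFailure (x' := x') i j hj hF hi (by omega) hi'.symm
      (by rw [hi', hj', hc])] at h
    · exact not_commonlyKnown_noFailure (by omega) (by omega) _ h
    · intro a
      by_cases ha : a = j
      · simp [ha]
      · rw [hi']
        simp [x', ha]

end Necessity

/-! ### Sufficiency: readiness gives common knowledge -/

section Sufficiency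

variable {t : ℕ} {P : DecisionProtocol (countFloodSet n)}

theorem commonKnowledge_of_ready {r : Run (countFloodSet n)} {x : Fin n → Value}
    {F : Adversary n} (hr : r ∈ system (countFloodSet n) t P) (hd : Describes t r x F) {m : ℕ}
    {i : Fin n} (hi : Alive F m i) (h : Ready t F m i) {w : Value} (hw : w ∈ seenSet F x m i) :
    CommonKnowledge (system (countFloodSet n) t P) (existsValue w) r m := by
  refine commonKnowledge_of_invariant (fun r m => ∃ x F i, Describes t r x F ∧ Alive F m i ∧
    Ready t F m i ∧ w ∈ seenSet F x m i) ?_ ?_ hr ⟨x, F, i, hd, hi, h, hw⟩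
  · rintro r - m ⟨x, F, i, hd, -, -, hw⟩
    exact hd.existsValue_iff.2 (exists_of_mem_seenSet hw)
  · rintro r - m ⟨x, F, i, hd, hi, h, hw⟩ j hj r' hr' m' hl
    have hj := hd.mem_nonfailed.1 hj
    obtain ⟨x', F', hd'⟩ := exists_describes hr'
    obtain ⟨hj', hs⟩ := hd'.of_loc_eq_some (hl.symm.trans (hd.loc_alive m j hj))
    simp only [CountState.mk.injEq] at hs
    obtain ⟨hs, hmiss, rfl, -⟩ := hs
    refine ⟨x', F', j, hd', hj', ?_, ?_⟩
    -- The state of `j` fixes only its own count and the time, so readiness is first moved from `i`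
    -- to `j` in the original run and then carried over.
    · rw [Ready, ← hmiss]
      exact h.of_alive hd.crash hi hj
    · rwa [← hs, ← h.seenSet_eq hd.crash x hi hj]

theorem exists_commonKnowledge_iff {r : Run (countFloodSet n)} {x : Fin n → Value}
    {F : Adversary n} (hr : r ∈ system (countFloodSet n) t P) (hd : Describes t r x F) {m : ℕ}
    {i : Fin n} (hi : Alive F m i) :
    (∃ w, CommonKnowledge (system (countFloodSet n) t P) (existsValue w) r m) ↔
      Ready t F m i :=
  ⟨fun ⟨_, h⟩ => CommonlyKnown.ready hd.crash hi ⟨r, hr, hd, h⟩,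
    fun h => ⟨x i, commonKnowledge_of_ready hr hd hi h (self_mem_seenSet F x m i)⟩⟩

end Sufficiency

/-! ### The decision rule: correctness, optimality, termination -/

section Rule

variable {t : ℕ} {r : Run (countFloodSet n)} {x : Fin n → Value} {F : Adversary n}

theorem decides_countRule_iff (hd : Describes t r x F) {m : ℕ} {i : Fin n} {v : Value} :
    Decides (countRule n t) r m i v ↔
      Alive F m i ∧ Ready t F m i ∧ v = (seenSet F x m i).inf id := by
  rw [Decides, hd.mem_nonfailed]
  refine and_congr_right fun hi => ?_
  rw [hd.loc_alive m i hi]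
  simp only [countRule, Ready]
  split_ifs with h1 h2 <;> simp [*, eq_comm]

theorem inf_mem_of_nonempty (S : Finset Value) (hS : S.Nonempty) : S.inf id ∈ S := by
  revert S; decide

theorem isSBA_countRule (n t : ℕ) : IsSBA (countFloodSet n) t (countRule n t) where
  agreement r hr m m' i j v v' h h' := by
    obtain ⟨x, F, hd⟩ := exists_describes hr
    wlog hm : m ≤ m' generalizing m m' i j v v'
    · exact (this m' m j i v' v h' h (le_of_not_ge hm)).symm
    obtain ⟨hi, hri, rfl⟩ := (decides_countRule_iff hd).1 h
    obtain ⟨hj, -, rfl⟩ := (decides_countRule_iff hd).1 h'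
    -- At the earlier decision all nonfailed agents share one seen set, which never changes
    -- afterwards; hence the minimum is the same.
    rw [seenSet_eq_of_uniform hd.crash hm
      (fun a ha => (hri.seenSet_eq hd.crash x hi ha).symm) j hj]
  validity r hr m i v h := by
    obtain ⟨x, F, hd⟩ := exists_describes hr
    obtain ⟨-, -, rfl⟩ := (decides_countRule_iff hd).1 h
    exact hd.existsValue_iff.2
      (exists_of_mem_seenSet (inf_mem_of_nonempty _ ⟨_, self_mem_seenSet F x m i⟩))
  simultaneity r hr m i v h j hj := by
    obtain ⟨x, F, hd⟩ := exists_describes hr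
    obtain ⟨hi, hri, -⟩ := (decides_countRule_iff hd).1 h
    have hj := hd.mem_nonfailed.1 hj
    exact ⟨_, (decides_countRule_iff hd).2 ⟨hj, hri.of_alive hd.crash hi hj, rfl⟩⟩

theorem isOptimumSBA_countRule (n t : ℕ) : IsOptimumSBA (countFloodSet n) t (countRule n t) := by
  refine ⟨isSBA_countRule n t, fun P' hP' r hr r' hr' hc m i v h => ?_⟩
  obtain ⟨x, F, hd⟩ := exists_describes hr
  -- Corresponding runs share inputs and crash pattern, so readiness derived under `P'` applies to
  -- the run of the rule.
  have hd' : Describes t r' x F := describes_of_mem hr' (hc.2.symm.trans hd.env)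
    fun a => (hc.1 a (x a)).1 (hd.loc_zero a)
  have hi := hd.mem_nonfailed.1 h.1
  exact ⟨_, (decides_countRule_iff hd').2
    ⟨hi, (exists_commonKnowledge_iff hr hd hi).1 ⟨v, hP'.commonKnowledge hr h⟩, rfl⟩⟩

theorem terminates_countRule (n t : ℕ) : Terminates (countFloodSet n) t (countRule n t) := by
  intro r hr i
  obtain ⟨x, F, hd⟩ := exists_describes hr
  refine ⟨min (t + 1) (n - 1), or_iff_not_imp_left.2 fun h => ?_⟩
  exact ⟨_, (decides_countRule_iff hd).2
    ⟨hd.mem_nonfailed.1 (not_not.1 h), .inl le_rfl, rfl⟩⟩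

end Rule

end SBA

theorem mainTheorem5 (n t : ℕ) (ht : t < n) :
    (∀ (P : SBA.DecisionProtocol (SBA.countFloodSet n)),
      ∀ r ∈ SBA.system (SBA.countFloodSet n) t P,
      ∀ (m : ℕ) (i : Fin n) (W : Finset SBA.Value) (h : ℕ) (v : SBA.Value),
        (r m).loc i = some (SBA.CountState.mk W h m v) →
        ((∃ w : SBA.Value, SBA.CommonKnowledge (SBA.system (SBA.countFloodSet n) t P)
            (SBA.existsValue w) r m) ↔
          (min (t + 1) (n - 1) ≤ m ∨ n - 1 ≤ h))) ∧
    SBA.IsOptimumSBA (SBA.countFloodSet n) t (SBA.countRule n t) ∧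
    SBA.Terminates (SBA.countFloodSet n) t (SBA.countRule n t) := by
  refine ⟨fun P r hr m i W h v hs => ?_, SBA.isOptimumSBA_countRule n t,
    SBA.terminates_countRule n t⟩
  obtain ⟨x, F, hd⟩ := SBA.exists_describes hr
  obtain ⟨hi, hs⟩ := hd.of_loc_eq_some hs
  obtain ⟨-, rfl, -, -⟩ := SBA.CountState.mk.injEq .. ▸ hs
  exact SBA.exists_commonKnowledge_iff hr hd hi
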